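/- \textbf{Setting.} A target language model generates $B\ge 1$ tokens by speculative decoding with $K\ge 2$ drafters and draft length $N_{\max}\ge 1$ over a finite vocabulary. In round $t$ one drafter $i$ is chosen and drafts $N_{\max}$ tokens; the $j$-th one is sampled from the drafter's next-token distribution $q_{i,t,j}$ and, if $p_{i,t,j}$ is the target model's next-token distribution at that position, it passes its test with probability $\min(1,p_{i,t,j}(y)/q_{i,t,j}(y))$, where $y$ is the drafted token. The number $N_{acc}(i,t)$ of accepted tokens is the number of drafted tokens before the first failed test, and the round generates $N_{acc}(i,t)+1$ tokens. The acceptance rates are $\alpha_{i,t,j}=1-d_{TV}(p_{i,t,j},q_{i,t,j})$ and the block-divergence (BD) reward of the round is $r_{i,t}=\frac1{N_{\max}}\sum_{j=1}^{N_{\max}}\alpha_{i,t,j}$. \textbf{Assumption.} For each drafter $i$ the acceptance rates of all its drafted tokens are i.i.d. with a law $\nu_i$ of mean $\alpha_i$: the pairs (acceptance rate, test outcome) of one drafter at the positions of one round are independent, and different rounds are independent (different drafters in the same round may be dependent). There is a drafter $i^\star$ with $\alpha_i<\alpha_{i^\star}$ for all $i\ne i^\star$. Put $\Delta(\alpha_i)=\alpha_{i^\star}-\alpha_i$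 and $S=\sum_{i\ne i^\star}\Delta(\alpha_i)^{-2}$. \textbf{Policies and regret.} A bandit policy chooses (possibly at random) the drafter of each round from the drafters, numbers of accepted tokens and rewards of the earlier rounds; $\tau(\pi,B)$ is the number of rounds that policy $\pi$ makes until at least $B$ tokens are generated, and $\pi^\star$ is a policy that minimizes $\mathbb E[\tau(\pi,B)]$ over all policies $\pi$. MetaSD-UCB with the BD reward uses each drafter once in the first $K$ rounds (which are always carried out) and thereafter, when $t$ rounds are complete and fewer than $B$ tokens are generated, a drafter that maximizes $\hat\mu_i+\beta\sqrt{2\ln t/n_i}$, where $n_i$ is the number of rounds with drafter $i$ so far and $\hat\mu_i$ the mean BD reward in them; ties are broken arbitrarily, and $\beta=1/\sqrt{N_{\max}}$. \textbf{Theorem.} For every $K$ there is a constant $C>0$, and for every $s>1$ a constant $C'>0$ depending only on $K$ and $s$, such that whenever $S\ge s$ (so that $\ln\ln S$ is defined and bounded below), an optimal policy $\pi^\star$ exists for every $B\ge1$, and MetaSD-UCB $\pi$ satisfies $$\mathbb E[\tau(\pi,B)]-\mathbb E[\tau(\pi^\star,B)]<\sum_{i\ne i^\star}\frac{8}{N_{\max}\,\Delta(\alpha_i)^2}\Bigl(\ln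 B+\ln\ln S+C'\Bigr)+C .$$ In particular $C$ and $C'$ do not depend on $B$, on $N_{\max}$, or on the laws $\nu_i$, hence not on the gaps other than through the lower bound $s$ on $S$. -/

import Mathlib

open MeasureTheory ProbabilityTheory Set

open scoped ENNReal

/-- Total variation distance of two probability vectors on a finite vocabulary. -/
noncomputable def tvDist {V : Type*} [Fintype V] (p q : V → ℝ) : ℝ :=
  (1 / 2) * ∑ v, |p v - q v|

/-- The random data of speculative decoding with `K` drafters and draft length `N`. The slot
`(t, i, j)` is the `j`-th drafted position of round `t` when drafter `i` is used in that round: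
`target` and `draft` are the next-token distributions of the target model and of drafter `i`
there, `token` is the drafted token and `coin` the random number used to verify it. -/
structure DraftTable (V : Type*) (K N : ℕ) (Ω : Type*) where
  target : ℕ → Fin K → Fin N → Ω → V → ℝ
  draft : ℕ → Fin K → Fin N → Ω → V → ℝ
  token : ℕ → Fin K → Fin N → Ω → V
  coin : ℕ → Fin K → Fin N → Ω → ℝ

namespace DraftTable

variable {V : Type*} [Fintype V] {K N : ℕ} {Ω : Type*}

/-- The acceptance rate of a drafted token: one minus the total variation distance. -/
noncomputable def rate (D : DraftTable V K N Ω) (t : ℕ) (i : Fin K) (j : Fin N) (ω : Ω) : ℝ :=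
  1 - tvDist (D.target t i j ω) (D.draft t i j ω)

/-- The verification test of speculative sampling. -/
def Accepted (D : DraftTable V K N Ω) (t : ℕ) (i : Fin K) (j : Fin N) (ω : Ω) : Prop :=
  D.coin t i j ω <
    min 1 (D.target t i j ω (D.token t i j ω) / D.draft t i j ω (D.token t i j ω))

open Classical in
/-- Number of accepted tokens in round `t` with drafter `i`: the drafted tokens up to the first
one that fails its test. -/
noncomputable def numAccepted (D : DraftTable V K N Ω) (t : ℕ) (i : Fin K) (ω : Ω) : ℕ :=
  (Finset.univ.filter fun j : Fin N => ∀ k ≤ j, D.Accepted t i k ω).card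

/-- Block divergence reward of drafter `i` in round `t`. -/
noncomputable def bdReward (D : DraftTable V K N Ω) (t : ℕ) (i : Fin K) (ω : Ω) : ℝ :=
  (1 / (N : ℝ)) * ∑ j, D.rate t i j ω

/-- Speculative sampling with stationary acceptance rates: at every slot the drafted token is
sampled from the drafter's distribution and tested with an independent uniform coin; the
acceptance rates of drafter `i` are i.i.d. with law `ν i`. Independence is required only of the
acceptance rates and test outcomes; different drafters in the same round may be dependent. -/
structure IsStationary [MeasurableSpace Ω] (D : DraftTable V K N Ω) (P : Measure Ω)
    (ν : Fin K → Measure ℝ) : Prop where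
  measurable_target : ∀ t i j, Measurable (D.target t i j)
  measurable_draft : ∀ t i j, Measurable (D.draft t i j)
  measurable_token : ∀ t i j v, MeasurableSet {ω | D.token t i j ω = v}
  measurable_coin : ∀ t i j, Measurable (D.coin t i j)
  target_mem : ∀ t i j ω, D.target t i j ω ∈ stdSimplex ℝ V
  draft_mem : ∀ t i j ω, D.draft t i j ω ∈ stdSimplex ℝ V
  /-- Given both next-token distributions, the token has the drafter's distribution and the coin
  is uniform on `[0, 1]` and independent of the token. -/
  sampling : ∀ t i j (S : Set ((V → ℝ) × (V → ℝ))) (v : V) (T : Set ℝ),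
    MeasurableSet S → MeasurableSet T →
    P {ω | (D.target t i j ω, D.draft t i j ω) ∈ S ∧ D.token t i j ω = v ∧ D.coin t i j ω ∈ T} =
      (∫⁻ ω in {ω | (D.target t i j ω, D.draft t i j ω) ∈ S},
        ENNReal.ofReal (D.draft t i j ω v) ∂P) * volume (T ∩ Icc 0 1)
  law_rate : ∀ t i j, P.map (D.rate t i j) = ν i
  indep_positions : ∀ t i,
    iIndepFun (fun (j : Fin N) (ω : Ω) => (D.rate t i j ω, D.Accepted t i j ω)) P
  indep_rounds :
    iIndepFun (fun (t : ℕ) (ω : Ω) (i : Fin K) (j : Fin N) =>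
      (D.rate t i j ω, D.Accepted t i j ω)) P

end DraftTable

/-- What is recorded about a round: the drafter, the number of accepted tokens, the reward. -/
abbrev RoundObs (K : ℕ) : Type := Fin K × ℕ × ℝ

/-- A (possibly randomized) bandit policy: after `n` rounds it chooses the next drafter from a
uniform random seed and the record of these rounds. It makes `warmup` rounds before it first
compares the number of generated tokens with the target. -/
structure BanditPolicy (K : ℕ) where
  warmup : ℕ
  choose : (n : ℕ) → ℝ → (Fin n → RoundObs K) → Fin K
  measurable_choose : ∀ n, Measurable fun x : ℝ × (Fin n → RoundObs K) => choose n x.1 x.2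

namespace BanditPolicy

variable {V : Type*} [Fintype V] {K N : ℕ} {Ω : Type*}

/-- The record of the first `n` rounds. -/
noncomputable def history (π : BanditPolicy K) (D : DraftTable V K N Ω) (u : ℝ) (ω : Ω) :
    (n : ℕ) → Fin n → RoundObs K
  | 0 => Fin.elim0
  | n + 1 =>
    let h := history π D u ω n
    let a := π.choose n u h
    Fin.snoc (α := fun _ => RoundObs K) h (a, D.numAccepted n a ω, D.bdReward n a ω)

/-- Number of tokens generated in the first `n` rounds: every round yields its accepted tokens
and one more token from the target model. -/
noncomputable def generated (π : BanditPolicy K) (D : DraftTable V K N Ω) (u : ℝ) (ω : Ω)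
    (n : ℕ) : ℕ :=
  ∑ s : Fin n, ((π.history D u ω n s).2.1 + 1)

/-- Total number of rounds until `B` tokens are generated. -/
noncomputable def rounds (π : BanditPolicy K) (D : DraftTable V K N Ω) (B : ℕ) (u : ℝ) (ω : Ω) :
    ℕ :=
  sInf {n | π.warmup ≤ n ∧ B ≤ π.generated D u ω n}

/-- Expected total number of rounds. -/
noncomputable def expectedRounds [MeasurableSpace Ω] (π : BanditPolicy K)
    (D : DraftTable V K N Ω) (P : Measure Ω) (B : ℕ) : ℝ≥0∞ :=
  ∫⁻ u in Icc (0 : ℝ) 1, ∫⁻ ω, (π.rounds D B u ω : ℝ≥0∞) ∂P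

/-- The run always ends, after at most `max warmup B` rounds. -/
theorem rounds_spec (π : BanditPolicy K) (D : DraftTable V K N Ω) (B : ℕ) (u : ℝ) (ω : Ω) :
    (π.warmup ≤ π.rounds D B u ω ∧ B ≤ π.generated D u ω (π.rounds D B u ω)) ∧
      π.rounds D B u ω ≤ max π.warmup B := by
  have hmem : max π.warmup B ∈ {n | π.warmup ≤ n ∧ B ≤ π.generated D u ω n} := by
    refine ⟨le_max_left _ _, (le_max_right π.warmup B).trans ?_⟩
    unfold generated
    calc max π.warmup B = ∑ _s : Fin (max π.warmup B), 1 := by simp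
      _ ≤ _ := Finset.sum_le_sum fun s _ => Nat.le_add_left _ _
  exact ⟨Nat.sInf_mem ⟨_, hmem⟩, Nat.sInf_le hmem⟩

/-- The expected number of rounds is finite. -/
theorem expectedRounds_ne_top [MeasurableSpace Ω] (π : BanditPolicy K)
    (D : DraftTable V K N Ω) (P : Measure Ω) [IsProbabilityMeasure P] (B : ℕ) :
    π.expectedRounds D P B ≠ ∞ := by
  have h : π.expectedRounds D P B ≤ ((max π.warmup B : ℕ) : ℝ≥0∞) := by
    unfold expectedRounds
    calc _ ≤ ∫⁻ _u in Icc (0 : ℝ) 1, ∫⁻ _ω, ((max π.warmup B : ℕ) : ℝ≥0∞) ∂P :=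
          lintegral_mono fun u => lintegral_mono fun ω => by
            exact Nat.cast_le.2 (π.rounds_spec D B u ω).2
      _ = _ := by simp
  exact ne_top_of_le_ne_top (ENNReal.natCast_ne_top _) h

/-- A policy that minimizes the expected number of rounds. -/
def IsOptimal [MeasurableSpace Ω] (π : BanditPolicy K) (D : DraftTable V K N Ω) (P : Measure Ω)
    (B : ℕ) : Prop :=
  ∀ π' : BanditPolicy K, π.expectedRounds D P B ≤ π'.expectedRounds D P B

/-- Stopping time regret of `π` relative to `πstar` (both expectations are finite). -/
noncomputable def regret [MeasurableSpace Ω] (π πstar : BanditPolicy K)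
    (D : DraftTable V K N Ω) (P : Measure Ω) (B : ℕ) : ℝ :=
  (π.expectedRounds D P B).toReal - (πstar.expectedRounds D P B).toReal

/-- Number of rounds in which drafter `i` was used. -/
def pulls {n : ℕ} (h : Fin n → RoundObs K) (i : Fin K) : ℕ :=
  (Finset.univ.filter fun s => (h s).1 = i).card

/-- Mean reward observed for drafter `i`. -/
noncomputable def empMean {n : ℕ} (h : Fin n → RoundObs K) (i : Fin K) : ℝ :=
  (∑ s ∈ Finset.univ.filter fun s => (h s).1 = i, (h s).2.2) / (pulls h i : ℝ)

/-- The upper confidence index of drafter `i` after `n` rounds. -/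
noncomputable def ucbIndex (β : ℝ) {n : ℕ} (h : Fin n → RoundObs K) (i : Fin K) : ℝ :=
  empMean h i + β * √(2 * Real.log n / (pulls h i : ℝ))

/-- `π` is MetaSD-UCB with exploration parameter `β`: each drafter is used once in the first `K`
rounds, which are always carried out; from then on a drafter of maximal index is used (ties are
broken arbitrarily). -/
structure IsMetaSDUCB (π : BanditPolicy K) (β : ℝ) : Prop where
  warmup_eq : π.warmup = K
  initial : ∀ (n : ℕ) (hn : n < K) (u : ℝ) (h : Fin n → RoundObs K), π.choose n u h = ⟨n, hn⟩
  argmax : ∀ (n : ℕ), K ≤ n → ∀ (u : ℝ) (h : Fin n → RoundObs K) (i : Fin K),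
    ucbIndex β h i ≤ ucbIndex β h (π.choose n u h)

end BanditPolicy

/-! Fix the best drafter `k` and let V(b) be the expected number of rounds needed to generate b
tokens with `k` alone (`singleRounds`). V serves as a potential, evaluated at the number of tokens
still missing.

An acceptance test succeeds with probability Σ_v min(p(v), q(v)) = 1 - d_TV given p and q, hence
with probability α_i overall. By independence of the positions, P(N_acc ≥ m) = α_i^m for m ≤ N. So
the number of accepted tokens is stochastically increasing in α_i, and V(b - N_acc), which is
antitone in N_acc, has its least expectation for the best drafter. Two bounds follow. Lower bound:
in an unfinished round of any policy the potential drops by at most 1 in expectation, so no policy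
needs fewer than V(B) rounds on average (`le_lintegral_singleRounds_add`). Always using `k` attains
V(B) and is therefore optimal. Upper bound: an unfinished round with `k` lowers the potential by
exactly 1 in expectation, and a round with another drafter does not raise it. Hence every policy
needs at most V(B), plus its warm-up, plus its expected number of uses of other drafters in B rounds
(`lintegral_singleRounds_add_le`).

It remains to count the suboptimal uses of UCB. The BD reward averages N independent variables in
[0, 1], so it is sub-Gaussian with variance proxy 1/(4N), and the factor β = 1/√N is the matching
scale of the confidence radius. A supermartingale bound and a union over the number of pulls show
that a confidence bound fails on one side after n rounds with probability at most n⁻³, which is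
summable. Outside these failures, drafter i is chosen only while its count is below 8 ln n/(N Δ_i²).
This already gives regret at most Σ 8 ln B/(N Δ_i²) plus a constant; the term ln ln S + C' is only
nonnegative slack. -/

namespace BanditPolicy

/-! ### Pathwise facts: token counts, pull counts and the UCB index. -/

variable {V : Type*} [Fintype V] {K N : ℕ} {Ω : Type*}

/-- The drafter used in round `n`. -/
noncomputable def action (π : BanditPolicy K) (D : DraftTable V K N Ω) (u : ℝ) (n : ℕ) (ω : Ω) :
    Fin K :=
  π.choose n u (π.history D u ω n)

theorem history_apply (π : BanditPolicy K) (D : DraftTable V K N Ω) (u : ℝ) (ω : Ω) (n : ℕ)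
    (s : Fin n) :
    π.history D u ω n s = (π.action D u s ω, D.numAccepted s (π.action D u s ω) ω,
      D.bdReward s (π.action D u s ω) ω) := by
  induction n with
  | zero => exact s.elim0
  | succ n ih =>
    refine Fin.lastCases ?_ (fun s => ?_) s
    · simp [history, action]
    · simpa [history] using ih s

theorem generated_eq_sum (π : BanditPolicy K) (D : DraftTable V K N Ω) (u : ℝ) (ω : Ω) (n : ℕ) :
    π.generated D u ω n = ∑ s ∈ Finset.range n, (D.numAccepted s (π.action D u s ω) ω + 1) := by
  simp only [generated, history_apply]
  exact Fin.sum_univ_eq_sum_range (fun s => D.numAccepted s (π.action D u s ω) ω + 1) n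

theorem generated_zero (π : BanditPolicy K) (D : DraftTable V K N Ω) (u : ℝ) (ω : Ω) :
    π.generated D u ω 0 = 0 := by
  simp [generated]

theorem generated_succ (π : BanditPolicy K) (D : DraftTable V K N Ω) (u : ℝ) (ω : Ω) (n : ℕ) :
    π.generated D u ω (n + 1) =
      π.generated D u ω n + (D.numAccepted n (π.action D u n ω) ω + 1) := by
  rw [generated_eq_sum, Finset.sum_range_succ, ← generated_eq_sum]

theorem monotone_generated (π : BanditPolicy K) (D : DraftTable V K N Ω) (u : ℝ) (ω : Ω) :
    Monotone (π.generated D u ω) :=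
  monotone_nat_of_le_succ fun n => by rw [generated_succ]; omega

theorem le_generated (π : BanditPolicy K) (D : DraftTable V K N Ω) (u : ℝ) (ω : Ω) (n : ℕ) :
    n ≤ π.generated D u ω n := by
  induction n with
  | zero => simp
  | succ n ih => rw [generated_succ]; omega

/-- The number of rounds, among the first `B`, that start with fewer than `B` tokens. -/
noncomputable def unfinishedRounds (π : BanditPolicy K) (D : DraftTable V K N Ω) (B : ℕ) (u : ℝ)
    (ω : Ω) : ℕ :=
  ((Finset.range B).filter fun r => π.generated D u ω r < B).card

theorem unfinishedRounds_le_rounds (π : BanditPolicy K) (D : DraftTable V K N Ω) (B : ℕ) (u : ℝ)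
    (ω : Ω) : π.unfinishedRounds D B u ω ≤ π.rounds D B u ω := by
  rw [← Finset.card_range (π.rounds D B u ω)]
  refine Finset.card_le_card fun r hr => ?_
  simp only [Finset.mem_filter, Finset.mem_range] at hr ⊢
  by_contra! h
  have := (π.rounds_spec D B u ω).1.2
  have := π.monotone_generated D u ω h
  omega

/-- Together with `unfinishedRounds_le_rounds`, this replaces the stopping time by a sum of
indicators over a fixed range, whose expectation is computed round by round. Only the forced warm-up
rounds separate the two counts. -/
theorem rounds_le_warmup_add (π : BanditPolicy K) (D : DraftTable V K N Ω) (B : ℕ) (u : ℝ)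
    (ω : Ω) : π.rounds D B u ω ≤ π.warmup + π.unfinishedRounds D B u ω := by
  refine Nat.sInf_le ⟨Nat.le_add_right _ _, ?_⟩
  refine le_trans ?_ (π.monotone_generated D u ω (Nat.le_add_left _ π.warmup))
  -- Otherwise rounds 0, ..., `unfinishedRounds` would all be unfinished, one more than their number
  -- allows. They lie below B because r rounds generate at least r tokens.
  by_contra! h
  have hsub : Finset.range (π.unfinishedRounds D B u ω + 1) ⊆
      (Finset.range B).filter fun r => π.generated D u ω r < B := by
    intro r hr
    simp only [Finset.mem_filter, Finset.mem_range] at hr ⊢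
    have h1 := π.monotone_generated D u ω (Nat.lt_succ_iff.1 hr)
    have h2 := π.le_generated D u ω r
    omega
  have := Finset.card_le_card hsub
  rw [Finset.card_range] at this
  exact absurd this (by unfold unfinishedRounds; omega)

theorem pulls_history (π : BanditPolicy K) (D : DraftTable V K N Ω) (u : ℝ) (ω : Ω) (n : ℕ)
    (i : Fin K) :
    pulls (π.history D u ω n) i =
      ∑ s ∈ Finset.range n, if π.action D u s ω = i then 1 else 0 := by
  simp only [pulls, history_apply, Finset.card_filter]
  exact Fin.sum_univ_eq_sum_range (fun s => if π.action D u s ω = i then 1 else 0) n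

theorem pulls_history_succ (π : BanditPolicy K) (D : DraftTable V K N Ω) (u : ℝ) (ω : Ω) (n : ℕ)
    (i : Fin K) :
    pulls (π.history D u ω (n + 1)) i =
      pulls (π.history D u ω n) i + if π.action D u n ω = i then 1 else 0 := by
  rw [pulls_history, pulls_history, Finset.sum_range_succ]

theorem pulls_le {n : ℕ} (h : Fin n → RoundObs K) (i : Fin K) : pulls h i ≤ n :=
  (Finset.card_filter_le _ _).trans (by simp)

/-- Total reward observed for drafter `i`. -/
noncomputable def totalReward {n : ℕ} (h : Fin n → RoundObs K) (i : Fin K) : ℝ :=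
  ∑ s ∈ Finset.univ.filter fun s => (h s).1 = i, (h s).2.2

theorem totalReward_history_succ (π : BanditPolicy K) (D : DraftTable V K N Ω) (u : ℝ) (ω : Ω)
    (n : ℕ) (i : Fin K) :
    totalReward (π.history D u ω (n + 1)) i =
      totalReward (π.history D u ω n) i +
        if π.action D u n ω = i then D.bdReward n i ω else 0 := by
  have key : ∀ m, totalReward (π.history D u ω m) i =
      ∑ s ∈ Finset.range m, if π.action D u s ω = i then D.bdReward s i ω else 0 := fun m => by
    simp only [totalReward, history_apply, Finset.sum_filter]
    rw [← Fin.sum_univ_eq_sum_range]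
    refine Finset.sum_congr rfl fun s _ => ?_
    split_ifs with h
    · rw [h]
    · rfl
  rw [key, key, Finset.sum_range_succ]

/-- Pulls of an arm that find its counter below a level number at most the level. -/
theorem sum_pulls_lt_le (π : BanditPolicy K) (D : DraftTable V K N Ω) (u : ℝ) (ω : Ω) (i : Fin K)
    (L B : ℕ) :
    (∑ r ∈ Finset.range B,
      if π.action D u r ω = i ∧ pulls (π.history D u ω r) i < L then 1 else 0) ≤ L := by
  -- The induction needs the bound by the current counter as well: a counted pull raises that
  -- counter while it is still below L.
  suffices h : (∑ r ∈ Finset.range B,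
      if π.action D u r ω = i ∧ pulls (π.history D u ω r) i < L then 1 else 0) ≤
      min L (pulls (π.history D u ω B) i) from h.trans (min_le_left _ _)
  induction B with
  | zero => simp
  | succ n ih =>
    rw [Finset.sum_range_succ, pulls_history_succ]
    split_ifs <;> omega

theorem IsMetaSDUCB.pulls_pos {π : BanditPolicy K} {β : ℝ} (hπ : π.IsMetaSDUCB β)
    (D : DraftTable V K N Ω) (u : ℝ) (ω : Ω) {n : ℕ} (hn : K ≤ n) (i : Fin K) :
    0 < pulls (π.history D u ω n) i := by
  rw [pulls_history]
  refine Finset.sum_pos' (fun _ _ => Nat.zero_le _)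
    ⟨i, Finset.mem_range.2 (i.2.trans_le hn), ?_⟩
  simp [action, hπ.initial i i.2]

/-- If UCB uses a suboptimal arm that was used often, one of two empirical means is far off. -/
theorem IsMetaSDUCB.deviation {π : BanditPolicy K} (hN : 1 ≤ N)
    (hπ : π.IsMetaSDUCB (1 / √(N : ℝ))) (D : DraftTable V K N Ω) (u : ℝ) (ω : Ω) {n : ℕ}
    (hn : K ≤ n) {i j : Fin K} {a b : ℝ} (hab : a < b)
    (hi : π.action D u n ω = i)
    (hL : 8 * Real.log n / (N * (b - a) ^ 2) ≤ pulls (π.history D u ω n) i) :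
    (pulls (π.history D u ω n) i : ℝ) *
        (1 / √(N : ℝ) * √(2 * Real.log n / pulls (π.history D u ω n) i)) ≤
      totalReward (π.history D u ω n) i - pulls (π.history D u ω n) i * a ∨
    (pulls (π.history D u ω n) j : ℝ) *
        (1 / √(N : ℝ) * √(2 * Real.log n / pulls (π.history D u ω n) j)) ≤
      -(totalReward (π.history D u ω n) j - pulls (π.history D u ω n) j * b) := by
  have hu := hπ.argmax n hn u (π.history D u ω n) j
  change ucbIndex _ _ j ≤ ucbIndex _ _ (π.action D u n ω) at hu
  rw [hi] at hu
  have hpi : (0 : ℝ) < pulls (π.history D u ω n) i := by exact_mod_cast hπ.pulls_pos D u ω hn i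
  have hpj : (0 : ℝ) < pulls (π.history D u ω n) j := by exact_mod_cast hπ.pulls_pos D u ω hn j
  simp only [ucbIndex, empMean] at hu
  change totalReward _ j / _ + _ ≤ totalReward _ i / _ + _ at hu
  generalize (pulls (π.history D u ω n) i : ℝ) = p at *
  generalize (pulls (π.history D u ω n) j : ℝ) = q at *
  generalize totalReward (π.history D u ω n) i = x at *
  generalize totalReward (π.history D u ω n) j = y at *
  have hN' : (0 : ℝ) < N := by exact_mod_cast hN
  -- The assumed number of pulls makes the confidence radius of i at most half the gap.
  have hc : 2 * (1 / √(N : ℝ) * √(2 * Real.log n / p)) ≤ b - a := by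
    have h1 : √(8 * Real.log n / (N * p)) ≤ b - a := by
      rw [Real.sqrt_le_left (by linarith)]
      have : 0 < b - a := by linarith
      rw [div_le_iff₀ (by positivity)] at hL ⊢
      linarith
    have h2 : 2 * (1 / √(N : ℝ) * √(2 * Real.log n / p)) = √(8 * Real.log n / (N * p)) := by
      rw [show 8 * Real.log n / (N * p) = 2 ^ 2 * (1 / (N : ℝ)) * (2 * Real.log n / p) by
          field_simp; ring,
        Real.sqrt_mul (by positivity), Real.sqrt_mul (by positivity), Real.sqrt_sq (by norm_num),
        Real.sqrt_div zero_le_one, Real.sqrt_one]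
      ring
    linarith
  -- If both means were within their radii, the index of i would be below a plus two radii, hence
  -- below b, while the index of j would exceed b.
  by_contra! hcon
  obtain ⟨h1, h2⟩ := hcon
  have h3 : x / p < a + 1 / √(N : ℝ) * √(2 * Real.log n / p) := by
    rw [div_lt_iff₀ hpi]; linarith
  have h4 : b - 1 / √(N : ℝ) * √(2 * Real.log n / q) < y / q := by
    rw [lt_div_iff₀ hpj]; linarith
  linarith

end BanditPolicy

/-! ### One round: acceptance probability, law of the accepted count, sub-Gaussian reward. -/

theorem one_sub_tvDist {V : Type*} [Fintype V] {p q : V → ℝ} (hp : p ∈ stdSimplex ℝ V)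
    (hq : q ∈ stdSimplex ℝ V) : 1 - tvDist p q = ∑ v, min (p v) (q v) := by
  have h : ∀ v, min (p v) (q v) = 1 / 2 * (p v + q v - |p v - q v|) := fun v => by
    rw [min_def]
    split_ifs with h
    · rw [abs_of_nonpos (by linarith)]; ring
    · rw [abs_of_nonneg (by linarith)]; ring
  simp_rw [h, ← Finset.mul_sum, Finset.sum_sub_distrib, Finset.sum_add_distrib, hp.2, hq.2, tvDist]
  ring

/-- An initial run of length at least `m`. -/
theorem le_card_initial_iff {N m : ℕ} (a : Fin N → Prop) [DecidablePred fun j => ∀ k ≤ j, a k]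
    (hm : m ≤ N) :
    m ≤ (Finset.univ.filter fun j : Fin N => ∀ k ≤ j, a k).card ↔
      ∀ j : Fin N, (j : ℕ) < m → a j := by
  constructor
  · intro h j hj
    by_contra hcon
    have hsub : (Finset.univ.filter fun j : Fin N => ∀ k ≤ j, a k) ⊆ Finset.Iio j := by
      intro l hl
      simp only [Finset.mem_filter, Finset.mem_univ, true_and, Finset.mem_Iio] at hl ⊢
      by_contra! hle
      exact hcon (hl j hle)
    have := Finset.card_le_card hsub
    rw [Fin.card_Iio] at this
    omega
  · intro h
    have hsub : (Finset.univ : Finset (Fin m)).map (Fin.castLEEmb hm) ⊆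
        Finset.univ.filter fun j : Fin N => ∀ k ≤ j, a k := by
      intro l hl
      simp only [Finset.mem_map, Finset.mem_univ, true_and] at hl
      obtain ⟨l, rfl⟩ := hl
      simp only [Finset.mem_filter, Finset.mem_univ, true_and]
      intro k hk
      exact h k (lt_of_le_of_lt (Fin.le_def.1 hk) l.2)
    simpa using Finset.card_le_card hsub

namespace DraftTable

variable {V : Type*} [Fintype V] {K N : ℕ} {Ω : Type*}

/-- Acceptance rates and test outcomes of one round. -/
noncomputable def row (D : DraftTable V K N Ω) (t : ℕ) (ω : Ω) : Fin K → Fin N → ℝ × Prop :=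
  fun i j => (D.rate t i j ω, D.Accepted t i j ω)

open Classical in
/-- Number of accepted tokens as a function of the row. -/
noncomputable def rowAccepted (z : Fin K → Fin N → ℝ × Prop) (i : Fin K) : ℕ :=
  (Finset.univ.filter fun j : Fin N => ∀ k ≤ j, (z i k).2).card

/-- Block divergence reward as a function of the row. -/
noncomputable def rowReward (z : Fin K → Fin N → ℝ × Prop) (i : Fin K) : ℝ :=
  (1 / (N : ℝ)) * ∑ j, (z i j).1

theorem rowAccepted_row (D : DraftTable V K N Ω) (t : ℕ) (i : Fin K) (ω : Ω) :
    rowAccepted (D.row t ω) i = D.numAccepted t i ω := rfl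

theorem rowReward_row (D : DraftTable V K N Ω) (t : ℕ) (i : Fin K) (ω : Ω) :
    rowReward (D.row t ω) i = D.bdReward t i ω := rfl

theorem measurable_rowAccepted (i : Fin K) :
    Measurable fun z : Fin K → Fin N → ℝ × Prop => rowAccepted z i := by
  classical
  have h : (fun z : Fin K → Fin N → ℝ × Prop => rowAccepted z i) =
      fun z => ∑ j : Fin N, if ∀ k ≤ j, (z i k).2 then 1 else 0 := by
    funext z
    rw [rowAccepted, Finset.card_filter]
  rw [h]
  refine Finset.measurable_sum _ fun j _ => ?_
  refine Measurable.ite ?_ measurable_const measurable_const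
  exact measurableSet_setOfPred.2
    (Measurable.forall fun k => Measurable.imp measurable_const (by fun_prop))

theorem measurable_rowReward (i : Fin K) :
    Measurable fun z : Fin K → Fin N → ℝ × Prop => rowReward z i := by
  unfold rowReward
  fun_prop

theorem rowAccepted_le (z : Fin K → Fin N → ℝ × Prop) (i : Fin K) : rowAccepted z i ≤ N := by
  classical
  exact (Finset.card_filter_le _ _).trans (by simp)

theorem numAccepted_le (D : DraftTable V K N Ω) (t : ℕ) (i : Fin K) (ω : Ω) :
    D.numAccepted t i ω ≤ N :=
  rowAccepted_le (D.row t ω) i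

namespace IsStationary

variable [MeasurableSpace Ω] {D : DraftTable V K N Ω} {P : Measure Ω} {ν : Fin K → Measure ℝ}

theorem measurable_rate (h : D.IsStationary P ν) (t : ℕ) (i : Fin K) (j : Fin N) :
    Measurable (D.rate t i j) := by
  have h1 := fun v => (measurable_pi_apply v).comp (h.measurable_target t i j)
  have h2 := fun v => (measurable_pi_apply v).comp (h.measurable_draft t i j)
  simp only [Function.comp_def] at h1 h2
  unfold rate tvDist
  refine measurable_const.sub (measurable_const.mul ?_)
  refine Finset.measurable_sum _ fun v _ => ?_
  simp_rw [← Real.norm_eq_abs]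
  exact ((h1 v).sub (h2 v)).norm

theorem measurableSet_accepted (h : D.IsStationary P ν) (t : ℕ) (i : Fin K) (j : Fin N) :
    MeasurableSet {ω | D.Accepted t i j ω} := by
  have h1 := fun v => (measurable_pi_apply v).comp (h.measurable_target t i j)
  have h2 := fun v => (measurable_pi_apply v).comp (h.measurable_draft t i j)
  simp only [Function.comp_def] at h1 h2
  have heq : {ω | D.Accepted t i j ω} = ⋃ v, {ω | D.token t i j ω = v} ∩
      {ω | D.coin t i j ω < min 1 (D.target t i j ω v / D.draft t i j ω v)} := by
    ext ω
    simp [Accepted]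
  rw [heq]
  exact MeasurableSet.iUnion fun v => (h.measurable_token t i j v).inter
    (measurableSet_lt (h.measurable_coin t i j) (measurable_const.min ((h1 v).div (h2 v))))

theorem measurable_row (h : D.IsStationary P ν) (t : ℕ) : Measurable (D.row t) :=
  measurable_pi_lambda _ fun i => measurable_pi_lambda _ fun j =>
    (h.measurable_rate t i j).prodMk (measurableSet_setOfPred.1 (h.measurableSet_accepted t i j))

theorem rate_mem_Icc (h : D.IsStationary P ν) (t : ℕ) (i : Fin K) (j : Fin N) (ω : Ω) :
    D.rate t i j ω ∈ Icc (0 : ℝ) 1 := by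
  have hp := h.target_mem t i j ω
  have hq := h.draft_mem t i j ω
  constructor
  · rw [rate, one_sub_tvDist hp hq]
    exact Finset.sum_nonneg fun v _ => le_min (hp.1 v) (hq.1 v)
  · rw [rate, tvDist]
    have : 0 ≤ ∑ v, |D.target t i j ω v - D.draft t i j ω v| :=
      Finset.sum_nonneg fun v _ => abs_nonneg _
    linarith

theorem integral_rate (h : D.IsStationary P ν) (t : ℕ) (i : Fin K) (j : Fin N) :
    ∫ ω, D.rate t i j ω ∂P = ∫ x, x ∂(ν i) := by
  rw [← h.law_rate t i j]
  exact (integral_map (f := fun x : ℝ => x) (h.measurable_rate t i j).aemeasurable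
    aestronglyMeasurable_id).symm

/-- Given p and q, the token is v with probability q(v), and the independent uniform coin then
passes with probability min(1, p(v)/q(v)). The product is min(p(v), q(v)). -/
theorem measure_token_accepted [IsProbabilityMeasure P] (h : D.IsStationary P ν) (t : ℕ)
    (i : Fin K) (j : Fin N) (v : V) :
    P {ω | D.token t i j ω = v ∧
        D.coin t i j ω < min 1 (D.target t i j ω v / D.draft t i j ω v)} =
      ∫⁻ ω, ENNReal.ofReal (min (D.target t i j ω v) (D.draft t i j ω v)) ∂P := by
  have h1 := h.measurable_target t i j
  have h2 := h.measurable_draft t i j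
  have hd : Measurable fun ω => ENNReal.ofReal (D.draft t i j ω v) :=
    ((measurable_pi_apply v).comp h2).ennreal_ofReal
  set X : Ω → (V → ℝ) × (V → ℝ) := fun ω => (D.target t i j ω, D.draft t i j ω) with hX
  have hXm : Measurable X := h1.prodMk h2
  have hcm := h.measurable_coin t i j
  set ρ : Measure Ω := P.withDensity fun ω => ENNReal.ofReal (D.draft t i j ω v) with hρ
  have hle1 : ∀ ω, D.draft t i j ω v ≤ 1 := fun ω => by
    have hq := h.draft_mem t i j ω
    rw [← hq.2]
    exact Finset.single_le_sum (f := D.draft t i j ω) (fun w _ => hq.1 w) (Finset.mem_univ v)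
  have : IsFiniteMeasure ρ := by
    refine isFiniteMeasure_withDensity (ne_top_of_le_ne_top ENNReal.one_ne_top ?_)
    calc _ ≤ ∫⁻ _ω, 1 ∂P := lintegral_mono fun ω => by simpa using hle1 ω
      _ = 1 := by simp
  -- On the event that the token is v, the coin is uniform and independent of (p, q), whose law is
  -- weighted by q(v). The sampling axiom says this on rectangles, and rectangles determine the
  -- product measure.
  have hprod : (ρ.map X).prod (volume.restrict (Icc (0 : ℝ) 1)) =
      (P.restrict {ω | D.token t i j ω = v}).map fun ω => (X ω, D.coin t i j ω) := by
    refine Measure.prod_eq fun S T hS hT => ?_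
    rw [Measure.map_apply (hXm.prodMk hcm) (hS.prod hT), Measure.map_apply hXm hS,
      Measure.restrict_apply ((hXm.prodMk hcm) (hS.prod hT)), Measure.restrict_apply hT,
      withDensity_apply _ (hXm hS)]
    refine Eq.trans ?_ (h.sampling t i j S v T hS hT)
    congr 1
    ext ω
    simp only [mem_inter_iff, mem_preimage, mem_prod, mem_ofPred_eq, hX]
    tauto
  have hA : MeasurableSet {x : ((V → ℝ) × (V → ℝ)) × ℝ | x.2 < min 1 (x.1.1 v / x.1.2 v)} := by
    refine measurableSet_lt measurable_snd (measurable_const.min (Measurable.div ?_ ?_)) <;>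
    fun_prop
  have hset : {ω | D.token t i j ω = v ∧
        D.coin t i j ω < min 1 (D.target t i j ω v / D.draft t i j ω v)} =
      ((fun ω => (X ω, D.coin t i j ω)) ⁻¹'
        {x : ((V → ℝ) × (V → ℝ)) × ℝ | x.2 < min 1 (x.1.1 v / x.1.2 v)}) ∩
        {ω | D.token t i j ω = v} := by
    ext ω
    simp only [mem_inter_iff, mem_preimage, mem_ofPred_eq, hX]
    tauto
  rw [hset, ← Measure.restrict_apply ((hXm.prodMk hcm) hA),
    ← Measure.map_apply (hXm.prodMk hcm) hA, ← hprod, Measure.prod_apply hA,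
    lintegral_map (measurable_measure_prodMk_left hA) hXm,
    hρ, lintegral_withDensity_eq_lintegral_mul _ hd
      (g := fun ω => (volume.restrict (Icc (0 : ℝ) 1)) (Prod.mk (X ω) ⁻¹'
        {x : ((V → ℝ) × (V → ℝ)) × ℝ | x.2 < min 1 (x.1.1 v / x.1.2 v)}))
      ((measurable_measure_prodMk_left hA).comp hXm)]
  refine lintegral_congr fun ω => ?_
  have hp0 := (h.target_mem t i j ω).1 v
  have hq0 := (h.draft_mem t i j ω).1 v
  have hset2 : (Prod.mk (X ω) ⁻¹'
      {x : ((V → ℝ) × (V → ℝ)) × ℝ | x.2 < min 1 (x.1.1 v / x.1.2 v)}) ∩ Icc 0 1 =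
      Ico 0 (min 1 (D.target t i j ω v / D.draft t i j ω v)) := by
    ext c
    simp only [mem_inter_iff, mem_preimage, mem_ofPred_eq, hX, mem_Icc, mem_Ico, lt_min_iff]
    constructor
    · tauto
    · rintro ⟨a, b, c⟩
      exact ⟨⟨b, c⟩, a, b.le⟩
  simp only [Pi.mul_apply]
  rw [Measure.restrict_apply (measurable_prodMk_left hA), hset2, Real.volume_Ico, sub_zero,
    ← ENNReal.ofReal_mul hq0]
  congr 1
  -- When q(v) = 0 the quotient has a default value, but the factor q(v) makes both sides zero.
  rcases hq0.eq_or_lt with h0 | h0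
  · rw [← h0, zero_mul, min_eq_right hp0]
  · rw [mul_min_of_nonneg _ _ hq0, mul_one, mul_div_cancel₀ _ h0.ne', min_comm]

/-- A drafted token is accepted with the mean acceptance rate. -/
theorem measure_accepted [IsProbabilityMeasure P] (h : D.IsStationary P ν) (t : ℕ)
    (i : Fin K) (j : Fin N) :
    P {ω | D.Accepted t i j ω} = ENNReal.ofReal (∫ x, x ∂(ν i)) := by
  have h1 := fun v => (measurable_pi_apply v).comp (h.measurable_target t i j)
  have h2 := fun v => (measurable_pi_apply v).comp (h.measurable_draft t i j)
  simp only [Function.comp_def] at h1 h2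
  have heq : {ω | D.Accepted t i j ω} = ⋃ v ∈ (Finset.univ : Finset V),
      {ω | D.token t i j ω = v ∧
        D.coin t i j ω < min 1 (D.target t i j ω v / D.draft t i j ω v)} := by
    ext ω
    simp [Accepted]
  rw [heq, measure_biUnion_finset, ← h.integral_rate t i j, ofReal_integral_eq_lintegral_ofReal]
  · rw [Finset.sum_congr rfl fun v _ => h.measure_token_accepted t i j v,
      ← lintegral_finsetSum]
    · refine lintegral_congr fun ω => ?_
      have hp := h.target_mem t i j ω
      have hq := h.draft_mem t i j ω
      rw [rate, one_sub_tvDist hp hq, ENNReal.ofReal_sum_of_nonneg]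
      exact fun v _ => le_min (hp.1 v) (hq.1 v)
    · exact fun v _ => ((h1 v).min (h2 v)).ennreal_ofReal
  · exact Integrable.of_mem_Icc 0 1 (h.measurable_rate t i j).aemeasurable
      (ae_of_all _ (h.rate_mem_Icc t i j))
  · exact ae_of_all _ fun ω => (h.rate_mem_Icc t i j ω).1
  · intro v _ w _ hvw
    refine disjoint_left.2 fun ω hv hw => hvw ?_
    rw [← hv.1, ← hw.1]
  · exact fun v _ => (h.measurable_token t i j v).inter
      (measurableSet_lt (h.measurable_coin t i j) (measurable_const.min ((h1 v).div (h2 v))))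

/-- The number of accepted tokens is a truncated geometric variable. -/
theorem measure_le_numAccepted [IsProbabilityMeasure P] (h : D.IsStationary P ν) (t : ℕ)
    (i : Fin K) (m : ℕ) :
    P {ω | m ≤ D.numAccepted t i ω} =
      if m ≤ N then ENNReal.ofReal (∫ x, x ∂(ν i)) ^ m else 0 := by
  split_ifs with hm
  · have heq : {ω | m ≤ D.numAccepted t i ω} =
        ⋂ j ∈ Finset.univ.filter (fun j : Fin N => (j : ℕ) < m), {ω | D.Accepted t i j ω} := by
      ext ω
      simp [numAccepted, le_card_initial_iff _ hm]
    rw [heq, (h.indep_positions t i).meas_biInter]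
    · rw [Finset.prod_congr rfl fun j _ => h.measure_accepted t i j, Finset.prod_const]
      congr 1
      have : Finset.univ.filter (fun j : Fin N => (j : ℕ) < m) =
          (Finset.univ : Finset (Fin m)).map (Fin.castLEEmb hm) := by
        ext j
        simp only [Finset.mem_filter, Finset.mem_univ, true_and, Finset.mem_map]
        exact ⟨fun hj => ⟨⟨j, hj⟩, rfl⟩, by rintro ⟨k, rfl⟩; exact k.2⟩
      simp [this]
    · intro j _
      exact ⟨{x | x.2}, measurableSet_setOfPred.2 measurable_snd, rfl⟩
  · have : {ω | m ≤ D.numAccepted t i ω} = ∅ := by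
      ext ω
      have := D.numAccepted_le t i ω
      simp only [mem_ofPred_eq, mem_empty_iff_false, iff_false]
      omega
    simp [this]

/-- Hoeffding's lemma for the block divergence reward. -/
theorem lintegral_exp_bdReward_le [IsProbabilityMeasure P] (h : D.IsStationary P ν) (hN : 1 ≤ N)
    (t : ℕ) (i : Fin K) (c : ℝ) :
    ∫⁻ ω, ENNReal.ofReal (Real.exp (c * (D.bdReward t i ω - ∫ x, x ∂(ν i)))) ∂P ≤
      ENNReal.ofReal (Real.exp (c ^ 2 / (8 * N))) := by
  have hN0 : (N : ℝ) ≠ 0 := by positivity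
  have hind : iIndepFun (fun (j : Fin N) (ω : Ω) => D.rate t i j ω - ∫ x, x ∂(ν i)) P :=
    (h.indep_positions t i).comp (fun _ x => x.1 - ∫ x, x ∂(ν i))
      fun _ => measurable_fst.sub_const _
  -- Each centred rate has variance proxy 1/4, their sum N/4, and the average 1/(4N).
  have hsub := (HasSubgaussianMGF.sum_of_iIndepFun hind (s := Finset.univ)
    (c := fun _ => (‖(1 : ℝ) - 0‖₊ / 2) ^ 2) fun j _ => by
      have := hasSubgaussianMGF_of_mem_Icc (h.measurable_rate t i j).aemeasurable
        (ae_of_all P (h.rate_mem_Icc t i j))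
      rwa [h.integral_rate] at this).const_mul (1 / (N : ℝ))
  have hrew : (fun ω => 1 / (N : ℝ) * ∑ j, (D.rate t i j ω - ∫ x, x ∂(ν i))) =
      fun ω => D.bdReward t i ω - ∫ x, x ∂(ν i) := by
    funext ω
    rw [Finset.sum_sub_distrib, bdReward, Finset.sum_const, Finset.card_univ, Fintype.card_fin,
      nsmul_eq_mul]
    field_simp
  rw [hrew] at hsub
  rw [← ofReal_integral_eq_lintegral_ofReal (hsub.integrable_exp_mul c)
    (ae_of_all _ fun ω => (Real.exp_pos _).le)]
  refine ENNReal.ofReal_le_ofReal ((hsub.mgf_le c).trans_eq ?_)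
  congr 1
  change (1 / (N : ℝ)) ^ 2 *
    ((∑ _j : Fin N, (‖(1 : ℝ) - 0‖₊ / 2) ^ 2 : NNReal) : ℝ) * c ^ 2 / 2 = _
  simp
  field_simp
  norm_num
  ring

end IsStationary

end DraftTable

/-! ### Stochastic order for bounded integer variables. -/

/-- Telescoping writes an antitone function as a constant plus nonnegative multiples of the
indicators of {x ≤ m}, so its expectation depends on tail probabilities only. -/
theorem Antitone.eq_add_sum_tsub {f : ℕ → ℝ≥0∞} (hf : Antitone f) {x M : ℕ} (hx : x ≤ M) :
    f x = f M + ∑ m ∈ Finset.range M, if x ≤ m then f m - f (m + 1) else 0 := by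
  induction M, hx using Nat.le_induction with
  | base =>
    rw [Finset.sum_eq_zero, add_zero]
    intro m hm
    rw [if_neg (by simpa using hm)]
  | succ M hM ih =>
    rw [Finset.sum_range_succ, if_pos hM, ih, add_comm (Finset.sum _ _), ← add_assoc,
      add_tsub_cancel_of_le (hf M.le_succ)]

/-- Expectations of antitone functions reverse the stochastic order. -/
theorem lintegral_antitone_le {Ω : Type*} [MeasurableSpace Ω] {P : Measure Ω}
    [IsProbabilityMeasure P] {X Y : Ω → ℕ} (hX : Measurable X) (hY : Measurable Y) {M : ℕ}
    (hXM : ∀ ω, X ω ≤ M) (hYM : ∀ ω, Y ω ≤ M)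
    (hXY : ∀ m, P {ω | m ≤ X ω} ≤ P {ω | m ≤ Y ω}) {f : ℕ → ℝ≥0∞} (hf : Antitone f) :
    ∫⁻ ω, f (Y ω) ∂P ≤ ∫⁻ ω, f (X ω) ∂P := by
  have key : ∀ {Z : Ω → ℕ}, Measurable Z → (∀ ω, Z ω ≤ M) → ∫⁻ ω, f (Z ω) ∂P =
      f M + ∑ m ∈ Finset.range M, (f m - f (m + 1)) * (1 - P {ω | m + 1 ≤ Z ω}) := by
    intro Z hZ hZM
    have hs : ∀ m, MeasurableSet {ω | Z ω ≤ m} := fun m => hZ (measurableSet_Iic (a := m))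
    have hc : ∀ m, P {ω | Z ω ≤ m} = 1 - P {ω | m + 1 ≤ Z ω} := fun m => by
      have h : MeasurableSet {ω | m + 1 ≤ Z ω} := hZ (measurableSet_Ici (a := m + 1))
      rw [← prob_compl_eq_one_sub h]
      congr 1
      ext ω
      simp
    have hf' : ∀ ω, f (Z ω) = f M + ∑ m ∈ Finset.range M,
        {ω | Z ω ≤ m}.indicator (fun _ => f m - f (m + 1)) ω := fun ω => by
      rw [hf.eq_add_sum_tsub (hZM ω)]
      simp [indicator]
    simp_rw [hf']
    rw [lintegral_add_left measurable_const, lintegral_finsetSum]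
    · simp [lintegral_indicator_const (hs _), hc]
    · exact fun m _ => measurable_const.indicator (hs m)
  rw [key hX hXM, key hY hYM]
  gcongr _ + ∑ m ∈ _, _ * (1 - ?_)
  exact hXY _

/-! ### Independence of the past from the next round. -/

namespace BanditPolicy

open DraftTable

variable {V : Type*} [Fintype V] {K N : ℕ} {Ω : Type*}

/-- The record after round `n`, given the previous record and the row of round `n`. -/
noncomputable def extend (π : BanditPolicy K) (u : ℝ) (n : ℕ)
    (x : (Fin n → RoundObs K) × (Fin K → Fin N → ℝ × Prop)) : Fin (n + 1) → RoundObs K :=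
  Fin.snoc (α := fun _ => RoundObs K) x.1
    (π.choose n u x.1, rowAccepted x.2 (π.choose n u x.1), rowReward x.2 (π.choose n u x.1))

theorem history_succ (π : BanditPolicy K) (D : DraftTable V K N Ω) (u : ℝ) (n : ℕ) (ω : Ω) :
    π.history D u ω (n + 1) = π.extend u n (π.history D u ω n, D.row n ω) := rfl

theorem measurable_choose_seed (π : BanditPolicy K) (u : ℝ) (n : ℕ) : Measurable (π.choose n u) :=
  (π.measurable_choose n).comp measurable_prodMk_left

theorem measurable_rowAccepted_choose (π : BanditPolicy K) (u : ℝ) (n : ℕ) :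
    Measurable fun x : (Fin n → RoundObs K) × (Fin K → Fin N → ℝ × Prop) =>
      rowAccepted x.2 (π.choose n u x.1) :=
  (measurable_from_prod_countable_left
    (f := fun y : (Fin K → Fin N → ℝ × Prop) × Fin K => rowAccepted y.1 y.2)
    fun i => measurable_rowAccepted i).comp
    (measurable_snd.prodMk ((π.measurable_choose_seed u n).comp measurable_fst))

theorem measurable_rowReward_choose (π : BanditPolicy K) (u : ℝ) (n : ℕ) :
    Measurable fun x : (Fin n → RoundObs K) × (Fin K → Fin N → ℝ × Prop) =>
      rowReward x.2 (π.choose n u x.1) :=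
  (measurable_from_prod_countable_left
    (f := fun y : (Fin K → Fin N → ℝ × Prop) × Fin K => rowReward y.1 y.2)
    fun i => measurable_rowReward i).comp
    (measurable_snd.prodMk ((π.measurable_choose_seed u n).comp measurable_fst))

theorem measurable_extend (π : BanditPolicy K) (u : ℝ) (n : ℕ) :
    Measurable (π.extend (N := N) u n) := by
  refine measurable_pi_lambda _ fun s => ?_
  refine Fin.lastCases ?_ (fun s => ?_) s
  · simp only [extend, Fin.snoc_last]
    exact ((π.measurable_choose_seed u n).comp measurable_fst).prodMk
      ((π.measurable_rowAccepted_choose u n).prodMk (π.measurable_rowReward_choose u n))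
  · simp only [extend, Fin.snoc_castSucc]
    exact (measurable_pi_apply s).comp measurable_fst

variable [MeasurableSpace Ω] {D : DraftTable V K N Ω} {P : Measure Ω} {ν : Fin K → Measure ℝ}

theorem measurable_history (π : BanditPolicy K) (hD : D.IsStationary P ν) (u : ℝ) (n : ℕ) :
    Measurable fun ω => π.history D u ω n := by
  induction n with
  | zero => exact measurable_pi_lambda _ fun s => s.elim0
  | succ n ih => exact (π.measurable_extend u n).comp (ih.prodMk (hD.measurable_row n))

theorem measurable_action (π : BanditPolicy K) (hD : D.IsStationary P ν) (u : ℝ) (n : ℕ) :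
    Measurable (π.action D u n) :=
  (π.measurable_choose_seed u n).comp (π.measurable_history hD u n)

theorem measurable_generated (π : BanditPolicy K) (hD : D.IsStationary P ν) (u : ℝ) (n : ℕ) :
    Measurable fun ω => π.generated D u ω n := by
  have := π.measurable_history hD u n
  unfold generated
  fun_prop

/-- The record of the first rounds is independent of the next round. -/
theorem indepFun_history_row (π : BanditPolicy K) (hD : D.IsStationary P ν) (u : ℝ) (n : ℕ) :
    IndepFun (fun ω => π.history D u ω n) (D.row n) P := by
  set m : ℕ → MeasurableSpace Ω := fun k =>
    MeasurableSpace.comap (D.row k) inferInstance with hm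
  -- For a fixed seed, the record of the first k rounds is a function of rows 0, ..., k - 1 only.
  have hmeas : ∀ k, Measurable[⨆ l ∈ Iio k, m l] fun ω => π.history D u ω k := by
    intro k
    induction k with
    | zero => exact @measurable_pi_lambda _ _ _ (_) _ _ fun s => s.elim0
    | succ k ih =>
      have h1 : Measurable[⨆ l ∈ Iio (k + 1), m l] fun ω => π.history D u ω k :=
        ih.mono (biSup_mono fun l hl => lt_trans hl k.lt_succ_self) le_rfl
      have h2 : Measurable[⨆ l ∈ Iio (k + 1), m l] (D.row k) :=
        (comap_measurable (D.row k)).mono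
          (le_biSup m (show k ∈ Iio (k + 1) from k.lt_succ_self)) le_rfl
      exact (π.measurable_extend u k).comp (h1.prodMk h2)
  have hind := indep_iSup_of_disjoint (m := m) (fun k => (hD.measurable_row k).comap_le)
    hD.indep_rounds (S := Iio n) (T := {n}) (by simp)
  rw [IndepFun_iff_Indep]
  refine indep_of_indep_of_le_left (indep_of_indep_of_le_right hind ?_) (hmeas n).comap_le
  simp [hm]

/-- Integrating out the next round. -/
theorem lintegral_history_row [IsProbabilityMeasure P] (π : BanditPolicy K)
    (hD : D.IsStationary P ν) (u : ℝ) (n : ℕ)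
    {F : (Fin n → RoundObs K) × (Fin K → Fin N → ℝ × Prop) → ℝ≥0∞} (hF : Measurable F) :
    ∫⁻ ω, F (π.history D u ω n, D.row n ω) ∂P =
      ∫⁻ ω, ∫⁻ ω', F (π.history D u ω n, D.row n ω') ∂P ∂P := by
  have h1 := π.measurable_history hD u n
  have h2 := hD.measurable_row n
  have h3 := (indepFun_iff_map_prod_eq_prod_map_map h1.aemeasurable h2.aemeasurable).1
    (π.indepFun_history_row hD u n)
  have := Measure.isProbabilityMeasure_map (μ := P) h2.aemeasurable
  rw [← lintegral_map hF (h1.prodMk h2), h3, lintegral_prod _ hF.aemeasurable,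
    lintegral_map hF.lintegral_prod_right' h1]
  exact lintegral_congr fun ω => lintegral_map (hF.comp measurable_prodMk_left) h2

end BanditPolicy

/-! ### The cost of using a single drafter. -/

namespace DraftTable

variable {V : Type*} {K N : ℕ} {Ω : Type*} [MeasurableSpace Ω]

/-- Expected number of rounds until `b` tokens are generated with drafter `i` only. -/
noncomputable def singleRounds (D : DraftTable V K N Ω) (P : Measure Ω) (i : Fin K) : ℕ → ℝ≥0∞
  | 0 => 0
  -- Round 0 stands for every round, since the law of the accepted count does not depend on the
  -- round. The truncated subtraction absorbs tokens generated beyond the target.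
  | b + 1 => 1 + ∫⁻ ω, singleRounds D P i (b - D.numAccepted 0 i ω) ∂P
  decreasing_by omega

variable {D : DraftTable V K N Ω} {P : Measure Ω} {ν : Fin K → Measure ℝ}

theorem singleRounds_zero (i : Fin K) : D.singleRounds P i 0 = 0 := by
  rw [singleRounds]

theorem singleRounds_succ (i : Fin K) (b : ℕ) : D.singleRounds P i (b + 1) =
    1 + ∫⁻ ω, D.singleRounds P i (b - D.numAccepted 0 i ω) ∂P := by
  rw [singleRounds]

theorem monotone_singleRounds (i : Fin K) : Monotone (D.singleRounds P i) := by
  refine monotone_nat_of_le_succ fun b => ?_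
  induction b using Nat.strong_induction_on with
  | _ b ih =>
    match b with
    | 0 => simp [singleRounds_zero]
    | b + 1 =>
      rw [singleRounds_succ, singleRounds_succ]
      gcongr with ω
      rcases Nat.lt_or_ge b (D.numAccepted 0 i ω) with h | h
      · rw [Nat.sub_eq_zero_of_le h.le, Nat.sub_eq_zero_of_le h]
      · rw [Nat.succ_sub h]
        exact ih _ (by omega)

theorem singleRounds_le [IsProbabilityMeasure P] (i : Fin K) (b : ℕ) :
    D.singleRounds P i b ≤ b := by
  induction b using Nat.strong_induction_on with
  | _ b ih =>
    match b with
    | 0 => simp [singleRounds_zero]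
    | b + 1 =>
      rw [singleRounds_succ, Nat.cast_add, Nat.cast_one, add_comm]
      gcongr
      calc _ ≤ ∫⁻ _ω, (b : ℝ≥0∞) ∂P := lintegral_mono fun ω =>
            (ih _ (by omega)).trans (Nat.cast_le.2 (Nat.sub_le _ _))
        _ = b := by simp

theorem antitone_singleRounds_sub (i : Fin K) (b : ℕ) :
    Antitone fun x => D.singleRounds P i (b - x) :=
  fun _ _ h => monotone_singleRounds i (Nat.sub_le_sub_left h b)

variable [Fintype V]

theorem IsStationary.measurable_numAccepted (hD : D.IsStationary P ν) (t : ℕ) (i : Fin K) :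
    Measurable (D.numAccepted t i) :=
  (measurable_rowAccepted i).comp (hD.measurable_row t)

/-- A drafter with the higher mean acceptance rate is better for antitone costs. -/
theorem IsStationary.lintegral_numAccepted_le [IsProbabilityMeasure P] (hD : D.IsStationary P ν)
    {i j : Fin K} (hij : ∫ x, x ∂(ν i) ≤ ∫ x, x ∂(ν j)) (t t' : ℕ) {f : ℕ → ℝ≥0∞}
    (hf : Antitone f) :
    ∫⁻ ω, f (D.numAccepted t j ω) ∂P ≤ ∫⁻ ω, f (D.numAccepted t' i ω) ∂P := by
  refine lintegral_antitone_le (hD.measurable_numAccepted t' i) (hD.measurable_numAccepted t j)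
    (D.numAccepted_le t' i) (D.numAccepted_le t j) (fun m => ?_) hf
  rw [hD.measure_le_numAccepted, hD.measure_le_numAccepted]
  split_ifs
  · gcongr
  · exact le_rfl

end DraftTable

/-! ### Comparison of policies through the potential. -/

namespace BanditPolicy

open DraftTable

variable {V : Type*} [Fintype V] {K N : ℕ} {Ω : Type*} [MeasurableSpace Ω]
  {D : DraftTable V K N Ω} {P : Measure Ω} {ν : Fin K → Measure ℝ}

/-- Expected remaining cost after one more round, before that round is sampled. -/
theorem lintegral_singleRounds_generated_succ [IsProbabilityMeasure P] (π : BanditPolicy K)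
    (hD : D.IsStationary P ν) (u : ℝ) (n B : ℕ) (k : Fin K) :
    ∫⁻ ω, D.singleRounds P k (B - π.generated D u ω (n + 1)) ∂P =
      ∫⁻ ω, (if π.generated D u ω n < B then ∫⁻ ω', D.singleRounds P k
        (B - π.generated D u ω n - 1 - D.numAccepted n (π.action D u n ω) ω') ∂P else 0) ∂P := by
  have hF : Measurable fun x : (Fin n → RoundObs K) × (Fin K → Fin N → ℝ × Prop) =>
      D.singleRounds P k (B - (∑ s, ((x.1 s).2.1 + 1) +
        (rowAccepted x.2 (π.choose n u x.1) + 1))) := by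
    refine Measurable.comp (measurable_of_countable _) ?_
    have := π.measurable_rowAccepted_choose (N := N) u n
    have h2 : Measurable fun x : (Fin n → RoundObs K) × (Fin K → Fin N → ℝ × Prop) =>
        ∑ s, ((x.1 s).2.1 + 1) := by fun_prop
    exact measurable_const.sub (h2.add (this.add_const 1))
  have h := π.lintegral_history_row hD u n hF
  have hl : ∀ ω, D.singleRounds P k (B - π.generated D u ω (n + 1)) =
      D.singleRounds P k (B - (∑ s, ((π.history D u ω n s).2.1 + 1) +
        (rowAccepted (D.row n ω) (π.choose n u (π.history D u ω n)) + 1))) := fun ω => by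
    rw [generated_succ]; rfl
  simp_rw [hl]
  rw [h]
  refine lintegral_congr fun ω => ?_
  change ∫⁻ ω', D.singleRounds P k (B - (π.generated D u ω n +
    (D.numAccepted n (π.action D u n ω) ω' + 1))) ∂P = _
  split_ifs with hB
  · refine lintegral_congr fun ω' => ?_
    congr 1
    omega
  · rw [← lintegral_zero (μ := P)]
    refine lintegral_congr fun ω' => ?_
    rw [Nat.sub_eq_zero_of_le (by omega), singleRounds_zero]

/-- The potential plus the number of unfinished rounds so far does not decrease in expectation: had
`k` been used, the potential would drop by exactly 1, and any other drafter leaves at least as much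
expected cost. -/
theorem le_lintegral_singleRounds_add [IsProbabilityMeasure P] (π : BanditPolicy K)
    (hD : D.IsStationary P ν) (u : ℝ) (B : ℕ) {k : Fin K}
    (hk : ∀ i, ∫ x, x ∂(ν i) ≤ ∫ x, x ∂(ν k)) (n : ℕ) :
    D.singleRounds P k B ≤ ∫⁻ ω, D.singleRounds P k (B - π.generated D u ω n) ∂P +
      ∑ r ∈ Finset.range n, ∫⁻ ω, (if π.generated D u ω r < B then 1 else 0) ∂P := by
  induction n with
  | zero => simp [generated_zero]
  | succ n ih =>
    refine ih.trans ?_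
    rw [Finset.sum_range_succ, add_comm (Finset.sum _ _), ← add_assoc,
      lintegral_singleRounds_generated_succ π hD]
    gcongr
    have hm : Measurable fun ω => (if π.generated D u ω n < B then 1 else 0 : ℝ≥0∞) :=
      Measurable.ite (π.measurable_generated hD u n (measurableSet_Iio (a := B)))
        measurable_const measurable_const
    rw [← lintegral_add_right _ hm]
    refine lintegral_mono fun ω => ?_
    dsimp only
    split_ifs with hB
    · obtain ⟨c, hc⟩ : ∃ c, B - π.generated D u ω n = c + 1 :=
        ⟨B - π.generated D u ω n - 1, by omega⟩
      rw [hc, singleRounds_succ, add_comm, Nat.add_sub_cancel]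
      gcongr ?_ + 1
      exact hD.lintegral_numAccepted_le (hk _) 0 n (antitone_singleRounds_sub (D := D) (P := P) k c)
    · rw [Nat.sub_eq_zero_of_le (by omega), singleRounds_zero]
      exact zero_le

/-- An unfinished round with `k` is paid for by an expected drop of 1 in the potential. With another
drafter the potential at least does not rise, so that round is charged to the deviation from `k`. -/
theorem lintegral_singleRounds_add_le [IsProbabilityMeasure P] (π : BanditPolicy K)
    (hD : D.IsStationary P ν) (u : ℝ) (B : ℕ) (k : Fin K) (n : ℕ) :
    ∫⁻ ω, D.singleRounds P k (B - π.generated D u ω n) ∂P +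
      ∑ r ∈ Finset.range n, ∫⁻ ω, (if π.generated D u ω r < B then 1 else 0) ∂P ≤
      D.singleRounds P k B + ∑ r ∈ Finset.range n, P {ω | π.action D u r ω ≠ k} := by
  induction n with
  | zero => simp [generated_zero]
  | succ n ih =>
    rw [Finset.sum_range_succ, Finset.sum_range_succ,
      ← add_assoc (D.singleRounds P k B)]
    refine le_trans ?_ (add_le_add_left ih _)
    rw [add_comm (Finset.sum _ _), ← add_assoc, add_right_comm _ (Finset.sum _ _) (P _),
      lintegral_singleRounds_generated_succ π hD]
    refine add_le_add_left ?_ _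
    have hm : Measurable fun ω => (if π.generated D u ω n < B then 1 else 0 : ℝ≥0∞) :=
      Measurable.ite (π.measurable_generated hD u n (measurableSet_Iio (a := B)))
        measurable_const measurable_const
    have hs : MeasurableSet {ω | π.action D u n ω ≠ k} :=
      (π.measurable_action hD u n (measurableSet_singleton k)).compl
    rw [← lintegral_add_right _ hm, ← lintegral_indicator_one hs,
      ← lintegral_add_right _ (measurable_one.indicator hs)]
    refine lintegral_mono fun ω => ?_
    dsimp only
    split_ifs with hB
    · obtain ⟨c, hc⟩ : ∃ c, B - π.generated D u ω n = c + 1 :=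
        ⟨B - π.generated D u ω n - 1, by omega⟩
      rw [hc, Nat.add_sub_cancel]
      by_cases ha : π.action D u n ω = k
      · rw [ha, singleRounds_succ, add_comm]
        refine le_add_right ?_
        gcongr 1 + ?_
        exact hD.lintegral_numAccepted_le le_rfl n 0 (antitone_singleRounds_sub (D := D) (P := P) k c)
      · rw [indicator_of_mem (show ω ∈ {ω | π.action D u n ω ≠ k} from ha)]
        gcongr
        · calc _ ≤ ∫⁻ _ω, D.singleRounds P k (c + 1) ∂P :=
                lintegral_mono fun ω' => monotone_singleRounds k (by omega)
            _ = _ := by simp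
        · simp
    · simp

theorem lintegral_unfinishedRounds (π : BanditPolicy K)
    (hD : D.IsStationary P ν) (u : ℝ) (B : ℕ) :
    ∫⁻ ω, (π.unfinishedRounds D B u ω : ℝ≥0∞) ∂P =
      ∑ r ∈ Finset.range B, ∫⁻ ω, (if π.generated D u ω r < B then 1 else 0) ∂P := by
  rw [← lintegral_finsetSum]
  · refine lintegral_congr fun ω => ?_
    rw [unfinishedRounds, Finset.card_filter]
    push_cast
    exact Finset.sum_congr rfl fun r _ => by congr
  · exact fun r _ => Measurable.ite (π.measurable_generated hD u r (measurableSet_Iio (a := B)))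
        measurable_const measurable_const

/-- Every round yields at least one token, so after B rounds the potential is used up and only the
round counts survive in the two comparisons. -/
theorem singleRounds_sub_generated (π : BanditPolicy K) (u : ℝ) (B : ℕ) (k : Fin K) (ω : Ω) :
    D.singleRounds P k (B - π.generated D u ω B) = 0 := by
  rw [Nat.sub_eq_zero_of_le (π.le_generated D u ω B), singleRounds_zero]

theorem lintegral_seed_const (c : ℝ≥0∞) : ∫⁻ _u in Icc (0 : ℝ) 1, c = c := by simp

/-- No policy beats the exclusive use of the best drafter. -/
theorem singleRounds_le_expectedRounds [IsProbabilityMeasure P] (π : BanditPolicy K)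
    (hD : D.IsStationary P ν) (B : ℕ) {k : Fin K} (hk : ∀ i, ∫ x, x ∂(ν i) ≤ ∫ x, x ∂(ν k)) :
    D.singleRounds P k B ≤ π.expectedRounds D P B := by
  rw [← lintegral_seed_const (D.singleRounds P k B)]
  refine lintegral_mono fun u => ?_
  refine (π.le_lintegral_singleRounds_add hD u B hk B).trans ?_
  simp only [singleRounds_sub_generated, lintegral_zero, zero_add]
  rw [← lintegral_unfinishedRounds π hD]
  exact lintegral_mono fun ω => Nat.cast_le.2 (π.unfinishedRounds_le_rounds D B u ω)

/-- Every policy pays one round for each warm-up round and each use of another drafter. -/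
theorem lintegral_rounds_le [IsProbabilityMeasure P] (π : BanditPolicy K)
    (hD : D.IsStationary P ν) (u : ℝ) (B : ℕ) (k : Fin K) :
    ∫⁻ ω, (π.rounds D B u ω : ℝ≥0∞) ∂P ≤ π.warmup + (D.singleRounds P k B +
      ∑ r ∈ Finset.range B, P {ω | π.action D u r ω ≠ k}) := by
  have h := π.lintegral_singleRounds_add_le hD u B k B
  simp only [singleRounds_sub_generated, lintegral_zero, zero_add] at h
  rw [← lintegral_unfinishedRounds π hD] at h
  calc _ ≤ ∫⁻ ω, ((π.warmup : ℝ≥0∞) + π.unfinishedRounds D B u ω) ∂P :=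
        lintegral_mono fun ω => by
          rw [← Nat.cast_add]
          exact Nat.cast_le.2 (π.rounds_le_warmup_add D B u ω)
    _ = π.warmup + ∫⁻ ω, (π.unfinishedRounds D B u ω : ℝ≥0∞) ∂P := by
        rw [lintegral_add_left measurable_const]
        simp
    _ ≤ _ := by gcongr

/-- The policy that always uses drafter `k`. -/
def single (k : Fin K) : BanditPolicy K where
  warmup := 0
  choose _ _ _ := k
  measurable_choose _ := measurable_const

theorem expectedRounds_single_le [IsProbabilityMeasure P] (hD : D.IsStationary P ν) (B : ℕ)
    (k : Fin K) : (single k).expectedRounds D P B ≤ D.singleRounds P k B := by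
  rw [← lintegral_seed_const (D.singleRounds P k B)]
  refine lintegral_mono fun u => ((single k).lintegral_rounds_le hD u B k).trans ?_
  simp [single, action]

theorem isOptimal_single [IsProbabilityMeasure P] (hD : D.IsStationary P ν) (B : ℕ) {k : Fin K}
    (hk : ∀ i, ∫ x, x ∂(ν i) ≤ ∫ x, x ∂(ν k)) : (single k).IsOptimal D P B :=
  fun π => (expectedRounds_single_le hD B k).trans (π.singleRounds_le_expectedRounds hD B hk)

end BanditPolicy

/-! ### Concentration and the number of suboptimal uses. -/

namespace BanditPolicy

open DraftTable

variable {V : Type*} [Fintype V] {K N : ℕ} {Ω : Type*} [MeasurableSpace Ω]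
  {D : DraftTable V K N Ω} {P : Measure Ω} {ν : Fin K → Measure ℝ}

theorem measurable_pulls {n : ℕ} (i : Fin K) :
    Measurable fun h : Fin n → RoundObs K => pulls h i := by
  simp only [pulls, Finset.card_filter]
  refine Finset.measurable_sum _ fun s _ => Measurable.ite ?_ measurable_const measurable_const
  exact (measurable_fst.comp (measurable_pi_apply s)) (measurableSet_singleton i)

theorem measurable_totalReward {n : ℕ} (i : Fin K) :
    Measurable fun h : Fin n → RoundObs K => totalReward h i := by
  simp only [totalReward, Finset.sum_filter]
  refine Finset.measurable_sum _ fun s _ => Measurable.ite ?_ (by fun_prop) measurable_const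
  exact (measurable_fst.comp (measurable_pi_apply s)) (measurableSet_singleton i)

/-- The exponential supermartingale of the observed rewards of drafter `i` with mean `a`. -/
noncomputable def expDeviation (N : ℕ) (a c : ℝ) (i : Fin K) {n : ℕ} (h : Fin n → RoundObs K) :
    ℝ≥0∞ :=
  ENNReal.ofReal (Real.exp
    (c * (totalReward h i - pulls h i * a) - pulls h i * (c ^ 2 / (8 * N))))

theorem measurable_expDeviation (N : ℕ) (a c : ℝ) (i : Fin K) {n : ℕ} :
    Measurable fun h : Fin n → RoundObs K => expDeviation N a c i h := by
  have h1 := measurable_totalReward (n := n) i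
  have h2 : Measurable fun h : Fin n → RoundObs K => (pulls h i : ℝ) :=
    measurable_from_top.comp (measurable_pulls (n := n) i)
  unfold expDeviation
  fun_prop

/-- A round with drafter i multiplies the process by exp(c(r - a) - c²/(8N)), whose expectation
given the past is at most 1 by Hoeffding's lemma. Other rounds leave it unchanged. Thus the adaptive
choice of drafters does no harm. -/
theorem lintegral_expDeviation_le [IsProbabilityMeasure P] (π : BanditPolicy K)
    (hD : D.IsStationary P ν) (hN : 1 ≤ N) (u c : ℝ) (i : Fin K) (n : ℕ) :
    ∫⁻ ω, expDeviation N (∫ x, x ∂(ν i)) c i (π.history D u ω n) ∂P ≤ 1 := by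
  set a := ∫ x, x ∂(ν i)
  induction n with
  | zero => simp [expDeviation, totalReward, pulls]
  | succ n ih =>
    set F : (Fin n → RoundObs K) × (Fin K → Fin N → ℝ × Prop) → ℝ≥0∞ := fun x =>
      expDeviation N a c i x.1 * if π.choose n u x.1 = i then
        ENNReal.ofReal (Real.exp (-(c ^ 2 / (8 * N)))) *
          ENNReal.ofReal (Real.exp (c * (rowReward x.2 i - a))) else 1 with hF
    have hFm : Measurable F := by
      refine ((measurable_expDeviation N a c i).comp measurable_fst).mul
        (Measurable.ite ?_ ?_ measurable_const)
      · exact ((π.measurable_choose_seed u n).comp measurable_fst) (measurableSet_singleton i)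
      · have : Measurable fun x : (Fin n → RoundObs K) × (Fin K → Fin N → ℝ × Prop) =>
            rowReward x.2 i := (measurable_rowReward i).comp measurable_snd
        fun_prop
    have hstep : ∀ ω, expDeviation N a c i (π.history D u ω (n + 1)) =
        F (π.history D u ω n, D.row n ω) := fun ω => by
      simp only [hF, expDeviation, rowReward_row, totalReward_history_succ, pulls_history_succ]
      change _ = _ * if π.action D u n ω = i then _ else _
      split_ifs
      · rw [← ENNReal.ofReal_mul (Real.exp_pos _).le, ← ENNReal.ofReal_mul (Real.exp_pos _).le,
          ← Real.exp_add, ← Real.exp_add]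
        congr 2
        push_cast
        ring
      · simp
    simp_rw [hstep]
    rw [π.lintegral_history_row hD u n hFm]
    refine le_trans (lintegral_mono fun ω => ?_) ih
    simp only [hF]
    rw [lintegral_const_mul' _ _ (by simp [expDeviation])]
    refine mul_le_of_le_one_right' ?_
    split_ifs
    · rw [lintegral_const_mul' _ _ (by simp)]
      calc _ ≤ ENNReal.ofReal (Real.exp (-(c ^ 2 / (8 * N)))) *
            ENNReal.ofReal (Real.exp (c ^ 2 / (8 * N))) := by
            gcongr
            exact hD.lintegral_exp_bdReward_le hN n i c
        _ = 1 := by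
            rw [← ENNReal.ofReal_mul (Real.exp_pos _).le, ← Real.exp_add]
            simp
    · simp

/-- Hoeffding's inequality at a given number of pulls; `σ` is the side of the deviation. -/
theorem measure_deviation_le [IsProbabilityMeasure P] (π : BanditPolicy K)
    (hD : D.IsStationary P ν) (hN : 1 ≤ N) (u : ℝ) (i : Fin K) (n p : ℕ) {σ δ : ℝ}
    (hσ : σ ^ 2 = 1) (hδ : 0 ≤ δ) :
    P {ω | pulls (π.history D u ω n) i = p ∧ p * δ ≤
        σ * (totalReward (π.history D u ω n) i - pulls (π.history D u ω n) i * ∫ x, x ∂(ν i))} ≤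
      ENNReal.ofReal (Real.exp (-(2 * N * p * δ ^ 2))) := by
  have hN0 : (0 : ℝ) < N := by exact_mod_cast hN
  set a := ∫ x, x ∂(ν i)
  -- Up to the sign σ, this c maximizes the Chernoff exponent c p δ - p c²/(8N), with value 2Npδ².
  set c := σ * (4 * N * δ) with hc
  set f : Ω → ℝ≥0∞ := fun ω => ENNReal.ofReal (Real.exp (-(2 * N * p * δ ^ 2))) *
    expDeviation N a c i (π.history D u ω n) with hf
  have hfm : Measurable f :=
    ((measurable_expDeviation N a c i).comp (π.measurable_history hD u n)).const_mul _
  calc _ ≤ 1 * P {ω | 1 ≤ f ω} := by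
        rw [one_mul]
        refine measure_mono fun ω ⟨hp, hω⟩ => ?_
        simp only [mem_ofPred_eq, hf, expDeviation]
        rw [← ENNReal.ofReal_mul (Real.exp_pos _).le, ← Real.exp_add, ENNReal.one_le_ofReal,
          Real.one_le_exp_iff]
        rw [hp] at hω ⊢
        have h1 : (p : ℝ) * (c ^ 2 / (8 * N)) = 2 * N * p * δ ^ 2 := by
          rw [hc, mul_pow, hσ]
          field_simp
          ring
        have h2 := mul_le_mul_of_nonneg_left hω (by positivity : 0 ≤ 4 * N * δ)
        rw [h1, hc]
        linarith
    _ ≤ ∫⁻ ω, f ω ∂P := mul_meas_ge_le_lintegral hfm 1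
    _ ≤ ENNReal.ofReal (Real.exp (-(2 * N * p * δ ^ 2))) * 1 := by
        rw [lintegral_const_mul' _ _ (by simp)]
        gcongr
        exact π.lintegral_expDeviation_le hD hN u c i n
    _ = _ := mul_one _

/-- After `n` rounds the empirical mean of a used drafter lies outside its confidence interval on
the side `σ` with probability at most `n⁻³`. -/
theorem measure_outside_confidence_le [IsProbabilityMeasure P] (π : BanditPolicy K)
    (hD : D.IsStationary P ν) (hN : 1 ≤ N) (u : ℝ) (i : Fin K) {n : ℕ} (hn : 1 ≤ n) {σ : ℝ}
    (hσ : σ ^ 2 = 1) :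
    P {ω | 0 < pulls (π.history D u ω n) i ∧ (pulls (π.history D u ω n) i : ℝ) *
        (1 / √(N : ℝ) * √(2 * Real.log n / pulls (π.history D u ω n) i)) ≤
        σ * (totalReward (π.history D u ω n) i - pulls (π.history D u ω n) i * ∫ x, x ∂(ν i))} ≤
      ENNReal.ofReal (1 / (n : ℝ) ^ 3) := by
  have hN0 : (0 : ℝ) < N := by exact_mod_cast hN
  have hn0 : (0 : ℝ) < n := by exact_mod_cast hn
  have hlog : 0 ≤ Real.log n := Real.log_nonneg (by exact_mod_cast hn)
  -- The number of pulls is random, so the deviation bound is applied to each possible value p in 1,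
  -- ..., n. Each costs n⁻⁴, and their union n⁻³.
  set E : ℕ → Set Ω := fun p => {ω | pulls (π.history D u ω n) i = p ∧
    p * (1 / √(N : ℝ) * √(2 * Real.log n / p)) ≤
      σ * (totalReward (π.history D u ω n) i - pulls (π.history D u ω n) i * ∫ x, x ∂(ν i))}
  have hE : ∀ p ∈ Finset.Icc 1 n, P (E p) ≤ ENNReal.ofReal (1 / (n : ℝ) ^ 4) := fun p hp => by
    have hp0 : (0 : ℝ) < p := by exact_mod_cast (Finset.mem_Icc.1 hp).1
    refine (π.measure_deviation_le hD hN u i n p hσ (by positivity)).trans_eq ?_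
    congr 1
    -- With δ equal to the confidence radius, the exponent 2Npδ² is 4 ln n for every p.
    rw [mul_pow, div_pow, Real.sq_sqrt hN0.le, Real.sq_sqrt (by positivity),
      show 2 * (N : ℝ) * p * (1 ^ 2 / N * (2 * Real.log n / p)) = Real.log n * (4 : ℕ) by
        field_simp; ring,
      Real.exp_neg, ← Real.rpow_def_of_pos hn0, Real.rpow_natCast, one_div]
  calc _ ≤ P (⋃ p ∈ Finset.Icc 1 n, E p) := by
        refine measure_mono fun ω hω => ?_
        exact mem_biUnion (Finset.mem_Icc.2 ⟨hω.1, pulls_le _ _⟩ :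
          pulls (π.history D u ω n) i ∈ Finset.Icc 1 n) ⟨rfl, hω.2⟩
    _ ≤ ∑ p ∈ Finset.Icc 1 n, P (E p) := measure_biUnion_finset_le _ _
    _ ≤ ∑ p ∈ Finset.Icc 1 n, ENNReal.ofReal (1 / (n : ℝ) ^ 4) := Finset.sum_le_sum hE
    _ = ENNReal.ofReal (n * (1 / (n : ℝ) ^ 4)) := by
        rw [Finset.sum_const, Nat.card_Icc, Nat.add_sub_cancel, nsmul_eq_mul,
          ENNReal.ofReal_mul hn0.le, ENNReal.ofReal_natCast]
    _ = _ := by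
        congr 1
        field_simp

/-- UCB uses an already well explored suboptimal drafter only rarely. -/
theorem IsMetaSDUCB.measure_action_le [IsProbabilityMeasure P] {π : BanditPolicy K}
    (hπ : π.IsMetaSDUCB (1 / √(N : ℝ))) (hD : D.IsStationary P ν) (hN : 1 ≤ N) (u : ℝ)
    {i j : Fin K} (hij : ∫ x, x ∂(ν i) < ∫ x, x ∂(ν j)) {n L : ℕ} (hn : K ≤ n)
    (hL : 8 * Real.log n / (N * (∫ x, x ∂(ν j) - ∫ x, x ∂(ν i)) ^ 2) ≤ L) :
    P {ω | π.action D u n ω = i ∧ L ≤ pulls (π.history D u ω n) i} ≤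
      ENNReal.ofReal (2 * (1 / (n : ℝ) ^ 3)) := by
  have hn1 : 1 ≤ n := le_trans (Nat.one_le_of_lt i.2) hn
  rw [two_mul, ENNReal.ofReal_add (by positivity) (by positivity)]
  refine le_trans ?_ ((measure_union_le _ _).trans (add_le_add
    (π.measure_outside_confidence_le hD hN u i hn1 (σ := 1) (by norm_num))
    (π.measure_outside_confidence_le hD hN u j hn1 (σ := -1) (by norm_num))))
  refine measure_mono fun ω ⟨hω, hp⟩ => ?_
  rcases hπ.deviation hN D u ω hn hij hω (hL.trans (by exact_mod_cast hp)) (j := j) with h | h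
  · exact Or.inl ⟨hπ.pulls_pos D u ω hn i, by rwa [one_mul]⟩
  · exact Or.inr ⟨hπ.pulls_pos D u ω hn j, by rwa [neg_one_mul]⟩

/-- Expected number of uses of a suboptimal drafter. -/
theorem IsMetaSDUCB.sum_measure_action_le [IsProbabilityMeasure P] {π : BanditPolicy K}
    (hπ : π.IsMetaSDUCB (1 / √(N : ℝ))) (hD : D.IsStationary P ν) (hN : 1 ≤ N) (u : ℝ)
    {i j : Fin K} (hij : ∫ x, x ∂(ν i) < ∫ x, x ∂(ν j)) (B : ℕ) :
    ∑ r ∈ Finset.range B, P {ω | π.action D u r ω = i} ≤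
      ENNReal.ofReal (8 / (N * (∫ x, x ∂(ν j) - ∫ x, x ∂(ν i)) ^ 2) * Real.log B +
        (1 + K + 2 * ∑' n : ℕ, 1 / (n : ℝ) ^ 3)) := by
  have hN0 : (0 : ℝ) < N := by exact_mod_cast hN
  have hgap : 0 < ∫ x, x ∂(ν j) - ∫ x, x ∂(ν i) := sub_pos.2 hij
  set g := ∫ x, x ∂(ν j) - ∫ x, x ∂(ν i)
  have hlogB : 0 ≤ Real.log B := Real.log_natCast_nonneg B
  -- Using ln B in place of ln r gives one threshold for all rounds r < B. Rounding up costs the 1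
  -- in the constant.
  set L := ⌈8 / (N * g ^ 2) * Real.log B⌉₊
  have hsum : Summable fun n : ℕ => 1 / (n : ℝ) ^ 3 :=
    Real.summable_one_div_nat_pow.2 (by norm_num)
  have hrare : ∀ r ∈ Finset.range B,
      P {ω | π.action D u r ω = i ∧ L ≤ pulls (π.history D u ω r) i} ≤
        (if r ∈ Finset.range K then 1 else 0) + ENNReal.ofReal (2 * (1 / (r : ℝ) ^ 3)) := by
    intro r hr
    rw [Finset.mem_range] at hr
    split_ifs with hrK
    -- In the first K rounds the choice is forced, so the trivial bound is used; this is the K in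
    -- the constant.
    · exact le_add_right prob_le_one
    · rw [zero_add]
      rw [Finset.mem_range, not_lt] at hrK
      refine hπ.measure_action_le hD hN u hij hrK (le_trans ?_ (Nat.le_ceil _))
      rw [div_mul_eq_mul_div]
      have hr0 : (0 : ℝ) < r := by
        exact_mod_cast lt_of_lt_of_le (Nat.zero_lt_of_lt i.2) hrK
      gcongr
  have hfew : ∑ r ∈ Finset.range B,
      P {ω | π.action D u r ω = i ∧ pulls (π.history D u ω r) i < L} ≤ L := by
    have hs : ∀ r, MeasurableSet {ω | π.action D u r ω = i ∧ pulls (π.history D u ω r) i < L} :=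
      fun r => (π.measurable_action hD u r (measurableSet_singleton i)).inter
        (((measurable_pulls i).comp (π.measurable_history hD u r)) (measurableSet_Iio (a := L)))
    simp_rw [← fun r => lintegral_indicator_one (μ := P) (hs r)]
    rw [← lintegral_finsetSum _ fun r _ => measurable_one.indicator (hs r)]
    calc _ ≤ ∫⁻ _ω, (L : ℝ≥0∞) ∂P := lintegral_mono fun ω => by
          refine le_trans (le_of_eq ?_) (Nat.cast_le.2 (π.sum_pulls_lt_le D u ω i L B))
          push_cast
          simp [indicator]
      _ = L := by simp
  calc _ ≤ ∑ r ∈ Finset.range B,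
        (P {ω | π.action D u r ω = i ∧ pulls (π.history D u ω r) i < L} +
          P {ω | π.action D u r ω = i ∧ L ≤ pulls (π.history D u ω r) i}) := by
        refine Finset.sum_le_sum fun r _ => le_trans (measure_mono fun ω hω => ?_)
          (measure_union_le _ _)
        rcases lt_or_ge (pulls (π.history D u ω r) i) L with h | h
        · exact Or.inl ⟨hω, h⟩
        · exact Or.inr ⟨hω, h⟩
    _ ≤ L + ∑ r ∈ Finset.range B,
        ((if r ∈ Finset.range K then 1 else 0) + ENNReal.ofReal (2 * (1 / (r : ℝ) ^ 3))) := by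
        rw [Finset.sum_add_distrib]
        exact add_le_add hfew (Finset.sum_le_sum hrare)
    _ ≤ L + (K + ENNReal.ofReal (2 * ∑' n : ℕ, 1 / (n : ℝ) ^ 3)) := by
        rw [Finset.sum_add_distrib]
        gcongr
        · rw [Finset.sum_ite_mem, Finset.sum_const, nsmul_eq_mul, mul_one, Nat.cast_le]
          exact (Finset.card_le_card Finset.inter_subset_right).trans (by simp)
        · rw [← ENNReal.ofReal_sum_of_nonneg fun r _ => by positivity, ← Finset.mul_sum]
          gcongr
          exact hsum.sum_le_tsum _ fun r _ => by positivity
    _ = ENNReal.ofReal (L + (K + 2 * ∑' n : ℕ, 1 / (n : ℝ) ^ 3)) := by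
        have : 0 ≤ ∑' n : ℕ, 1 / (n : ℝ) ^ 3 := tsum_nonneg fun n => by positivity
        rw [ENNReal.ofReal_add (by positivity) (by positivity),
          ENNReal.ofReal_add (by positivity) (by positivity), ENNReal.ofReal_natCast,
          ENNReal.ofReal_natCast]
    _ ≤ _ := by
        refine ENNReal.ofReal_le_ofReal ?_
        have : (L : ℝ) < 8 / (N * g ^ 2) * Real.log B + 1 := Nat.ceil_lt_add_one (by positivity)
        linarith

/-- Logarithmic regret of MetaSD-UCB relative to any policy. -/
theorem IsMetaSDUCB.regret_le [IsProbabilityMeasure P] {π πstar : BanditPolicy K}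
    (hπ : π.IsMetaSDUCB (1 / √(N : ℝ))) (hD : D.IsStationary P ν) (hN : 1 ≤ N) {k : Fin K}
    (hk : ∀ i, i ≠ k → ∫ x, x ∂(ν i) < ∫ x, x ∂(ν k)) (B : ℕ) :
    π.regret πstar D P B ≤
      ∑ i ∈ Finset.univ.erase k, 8 / (N * (∫ x, x ∂(ν k) - ∫ x, x ∂(ν i)) ^ 2) * Real.log B +
        (K + K * (1 + K + 2 * ∑' n : ℕ, 1 / (n : ℝ) ^ 3)) := by
  have hk' : ∀ i, ∫ x, x ∂(ν i) ≤ ∫ x, x ∂(ν k) := fun i => by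
    rcases eq_or_ne i k with rfl | h
    · exact le_rfl
    · exact (hk i h).le
  have hz : 0 ≤ ∑' n : ℕ, 1 / (n : ℝ) ^ 3 := tsum_nonneg fun n => by positivity
  have hlogB : 0 ≤ Real.log B := Real.log_natCast_nonneg B
  set R : ℝ := ∑ i ∈ Finset.univ.erase k,
    (8 / (N * (∫ x, x ∂(ν k) - ∫ x, x ∂(ν i)) ^ 2) * Real.log B +
      (1 + K + 2 * ∑' n : ℕ, 1 / (n : ℝ) ^ 3)) with hR
  have hR0 : 0 ≤ R := Finset.sum_nonneg fun i _ => by positivity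
  have hother : ∀ u, ∑ r ∈ Finset.range B, P {ω | π.action D u r ω ≠ k} ≤ ENNReal.ofReal R := by
    intro u
    calc _ ≤ ∑ r ∈ Finset.range B, ∑ i ∈ Finset.univ.erase k, P {ω | π.action D u r ω = i} := by
          refine Finset.sum_le_sum fun r _ => le_trans (measure_mono fun ω hω => ?_)
            (measure_biUnion_finset_le _ _)
          exact mem_biUnion (Finset.mem_erase.2 ⟨hω, Finset.mem_univ _⟩ :
            π.action D u r ω ∈ Finset.univ.erase k) rfl
      _ = ∑ i ∈ Finset.univ.erase k, ∑ r ∈ Finset.range B, P {ω | π.action D u r ω = i} :=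
          Finset.sum_comm
      _ ≤ _ := by
          rw [hR, ENNReal.ofReal_sum_of_nonneg fun i _ => by positivity]
          exact Finset.sum_le_sum fun i hi =>
            hπ.sum_measure_action_le hD hN u (hk i (Finset.ne_of_mem_erase hi)) B
  have hupper : π.expectedRounds D P B ≤
      D.singleRounds P k B + ENNReal.ofReal (K + R) := by
    rw [← lintegral_seed_const (D.singleRounds P k B + _)]
    refine lintegral_mono fun u => (π.lintegral_rounds_le hD u B k).trans ?_
    rw [hπ.warmup_eq, ENNReal.ofReal_add (by positivity) hR0, ENNReal.ofReal_natCast,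
      add_left_comm]
    gcongr
    exact hother u
  have hlower := πstar.singleRounds_le_expectedRounds hD B hk'
  have h1 : (π.expectedRounds D P B).toReal ≤
      (πstar.expectedRounds D P B).toReal + (K + R) := by
    rw [← ENNReal.toReal_ofReal (by positivity : 0 ≤ K + R), ← ENNReal.toReal_add
      (πstar.expectedRounds_ne_top D P B) ENNReal.ofReal_ne_top]
    refine ENNReal.toReal_mono
      (ENNReal.add_ne_top.2 ⟨πstar.expectedRounds_ne_top D P B, ENNReal.ofReal_ne_top⟩)
      (hupper.trans ?_)
    gcongr
  have h2 : R ≤ ∑ i ∈ Finset.univ.erase k,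
      8 / (N * (∫ x, x ∂(ν k) - ∫ x, x ∂(ν i)) ^ 2) * Real.log B +
        K * (1 + K + 2 * ∑' n : ℕ, 1 / (n : ℝ) ^ 3) := by
    rw [hR, Finset.sum_add_distrib, Finset.sum_const, nsmul_eq_mul]
    gcongr
    exact (Finset.card_le_univ _).trans (by simp)
  unfold regret
  linarith

end BanditPolicy

/-! ### The regret bound in its stated form. -/

theorem theorem2 (K : ℕ) :
    ∃ C : ℝ, 0 < C ∧ ∀ s : ℝ, 1 < s → ∃ C' : ℝ, 0 < C' ∧
      ∀ (N : ℕ), 1 ≤ N →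
      ∀ (V : Type*) [Fintype V] (Ω : Type*) [MeasurableSpace Ω]
        (P : Measure Ω) [IsProbabilityMeasure P]
        (D : DraftTable V K N Ω) (ν : Fin K → Measure ℝ), D.IsStationary P ν →
      ∀ (α Δ : Fin K → ℝ) (istar : Fin K), (∀ i, α i = ∫ x, x ∂(ν i)) →
        (∀ i, i ≠ istar → α i < α istar) → (∀ i, Δ i = α istar - α i) →
        s ≤ ∑ i ∈ Finset.univ.erase istar, 1 / Δ i ^ 2 →
      ∀ (B : ℕ), 1 ≤ B →
        (∃ πstar : BanditPolicy K, πstar.IsOptimal D P B) ∧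
        ∀ π πstar : BanditPolicy K, π.IsMetaSDUCB (1 / √(N : ℝ)) → πstar.IsOptimal D P B →
          π.regret πstar D P B <
            (∑ i ∈ Finset.univ.erase istar, 8 / ((N : ℝ) * Δ i ^ 2) *
              (Real.log B
                + Real.log (Real.log (∑ k ∈ Finset.univ.erase istar, 1 / Δ k ^ 2)) + C'))
            + C := by
  have hz : 0 ≤ ∑' n : ℕ, 1 / (n : ℝ) ^ 3 := tsum_nonneg fun n => by positivity
  -- In C, the first K pays for the warm-up, the product for the constants of the suboptimal
  -- drafters, and the final 1 makes the inequality strict. The choice of C' makes ln ln S + C'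
  -- nonnegative, because ln ln S ≥ ln ln s.
  refine ⟨K + K * (1 + K + 2 * ∑' n : ℕ, 1 / (n : ℝ) ^ 3) + 1, by positivity, fun s hs =>
    ⟨max 1 (-Real.log (Real.log s)), by positivity, ?_⟩⟩
  intro N hN V _ Ω _ P _ D ν hD α Δ k hα hk hΔ hS B _
  simp only [hα] at hk hΔ
  have hk' : ∀ i, ∫ x, x ∂(ν i) ≤ ∫ x, x ∂(ν k) := fun i => by
    rcases eq_or_ne i k with rfl | h
    · exact le_rfl
    · exact (hk i h).le
  refine ⟨⟨_, BanditPolicy.isOptimal_single hD B hk'⟩, fun π πstar hπ _ => ?_⟩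
  have hreg := hπ.regret_le (πstar := πstar) hD hN hk B
  simp only [← hΔ] at hreg
  have hlog : Real.log (Real.log s) ≤
      Real.log (Real.log (∑ i ∈ Finset.univ.erase k, 1 / Δ i ^ 2)) :=
    Real.log_le_log (Real.log_pos hs) (Real.log_le_log (by linarith) hS)
  have hsum : ∑ i ∈ Finset.univ.erase k, 8 / (N * Δ i ^ 2) * Real.log B ≤
      ∑ i ∈ Finset.univ.erase k, 8 / ((N : ℝ) * Δ i ^ 2) *
        (Real.log B + Real.log (Real.log (∑ k ∈ Finset.univ.erase k, 1 / Δ k ^ 2)) +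
          max 1 (-Real.log (Real.log s))) := by
    refine Finset.sum_le_sum fun i _ => mul_le_mul_of_nonneg_left ?_ (by positivity)
    have := le_max_right 1 (-Real.log (Real.log s))
    linarith
  linarith
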